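/- Let $T$ be the class of typically real functions, i.e. functions $f(z)=z+\sum_{k\ge 2}a_kz^k$ analytic in the open unit disc $\mathbb{D}$ that take real values at the real points of $\mathbb{D}$ and non-real values at all other points of $\mathbb{D}$. Let $f\in T$, let $\lambda\ge 1$ be real, and let $n,m\ge 2$ be integers. (i) If $n=2$ and $m$ is even, then $$|\lambda a_na_m-a_{n+m-1}|\le\begin{cases}3+(2\lambda-1)(m-2), & 1\le\lambda\le 3/2,\quad (a)\\ 2\lambda m-m-1, & \lambda\ge 3/2.\quad (b)\end{cases}$$ (ii) If $m=2$ and $n$ is even, then $$|\lambda a_na_m-a_{n+m-1}|\le\begin{cases}3+(2\lambda-1)(n-2), & 1\le\lambda\le 3/2,\quad (a)\\ 2\lambda n-n-1, & \lambda\ge 3/2.\quad (b)\end{cases}$$ (iii) In all other cases, $$|\lambda a_na_m-a_{n+m-1}|\le\lambda mn-n-m+1.$$ The bounds in (i)(b), (ii)(b) and (iii) are sharp, that is, for all such $n,m,\lambda$ equality holds for some $f\in T$. The bounds in (i)(a) and (ii)(a) are sharp in the same sense when $\lambda=1$ or when $n=m=2$. -/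

import Mathlib

/-- The class `𝒜`: functions analytic on the open unit disc with `f 0 = 0` and `f' 0 = 1`.
Only the values of `f` on the unit disc matter. -/
def NormalizedAnalytic : Set (ℂ → ℂ) :=
  {f | DifferentiableOn ℂ f (Metric.ball 0 1) ∧ f 0 = 0 ∧ deriv f 0 = 1}

/-- The class `T` of typically real functions: members of `𝒜` that take real values at the real
points of the unit disc and non-real values at all its other points. -/
def TypicallyReal : Set (ℂ → ℂ) :=
  {f | f ∈ NormalizedAnalytic ∧ ∀ z ∈ Metric.ball (0 : ℂ) 1, (f z).im = 0 ↔ z.im = 0}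

/-- The `n`-th Taylor coefficient `a_n` of `f` at the origin. -/
noncomputable def taylorCoeff (f : ℂ → ℂ) (n : ℕ) : ℂ :=
  iteratedDeriv n f 0 / (n.factorial : ℂ)

/-- The generalized Zalcman functional `φ(f, n, m; lam) = |lam * a_n * a_m - a_{n+m-1}|`. -/
noncomputable def zalcman (f : ℂ → ℂ) (n m : ℕ) (lam : ℝ) : ℝ :=
  ‖(lam : ℂ) * taylorCoeff f n * taylorCoeff f m - taylorCoeff f (n + m - 1)‖

/-!
Integrating `Im f(z) Im zⁿ` over `|z| = r` gives the `n`-th coefficient of `f`, and `Im f(z) Im z`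
is nonnegative for `f` in `T`. Since `sin nθ = U_{n-1}(cos θ) sin θ`, letting `r → 1` along a
weakly convergent sequence of measures shows that the coefficients are `a_n = ∫ U_{n-1} ∂μ` for a
probability measure `μ` on `[-1, 1]` (Robertson).

The moments `c_n = ∫ T_n ∂μ` satisfy `a_{n+2} = a_n + 2 c_{n+1}`, `|c_n| ≤ 1`, and, because
`(cos jθ ± cos kθ)² ≤ 2 (1 ± cos (j + k)θ)`, also `|2 c_j c_k - c_{j+k}| ≤ 1` by Jensen's
inequality. Passing from `n` to `n + 2` therefore increases the functional by at most
`2 (lam * m - 1)`, so that only the index pairs `(1, m)`, `(2, 2)` and `(4, 4)` remain.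
-/

open Complex Filter MeasureTheory Metric Polynomial Set Topology
open scoped ComplexConjugate

theorem taylorCoeff_eq_of_eventually_hasSum {f : ℂ → ℂ} {a : ℕ → ℂ}
    (h : ∀ᶠ z in 𝓝 0, HasSum (fun n => a n * z ^ n) (f z)) (n : ℕ) :
    taylorCoeff f n = a n := by
  have hseries : HasFPowerSeriesAt f (FormalMultilinearSeries.ofScalars ℂ a) 0 := by
    rw [hasFPowerSeriesAt_iff]
    filter_upwards [h] with z hz
    simpa [mul_comm] using hz
  have huniq := (AnalyticAt.hasFPowerSeriesAt ⟨_, hseries⟩).eq_formalMultilinearSeries hseries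
  simpa [taylorCoeff] using congrArg (fun p => FormalMultilinearSeries.coeff p n) huniq

theorem hasSum_taylorCoeff {f : ℂ → ℂ} (hf : DifferentiableOn ℂ f (ball 0 1)) {z : ℂ}
    (hz : z ∈ ball (0 : ℂ) 1) : HasSum (fun n => taylorCoeff f n * z ^ n) (f z) := by
  refine (Complex.hasSum_taylorSeries_on_ball hf hz).congr_fun fun n => ?_
  simp only [taylorCoeff, sub_zero, smul_eq_mul]
  ring

namespace TypicallyReal

variable {f : ℂ → ℂ} {z : ℂ}

theorem differentiableOn (hf : f ∈ TypicallyReal) : DifferentiableOn ℂ f (ball 0 1) := hf.1.1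

theorem taylorCoeff_zero (hf : f ∈ TypicallyReal) : taylorCoeff f 0 = 0 := by
  simp [taylorCoeff, hf.1.2.1]

theorem taylorCoeff_one (hf : f ∈ TypicallyReal) : taylorCoeff f 1 = 1 := by
  simp [taylorCoeff, hf.1.2.2]

theorem hasDerivAt_zero (hf : f ∈ TypicallyReal) : HasDerivAt f 1 0 :=
  hf.1.2.2 ▸ ((differentiableOn hf).differentiableAt (ball_mem_nhds 0 one_pos)).hasDerivAt

theorem taylorCoeff_im (hf : f ∈ TypicallyReal) (n : ℕ) : (taylorCoeff f n).im = 0 := by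
  have hzero : HasFPowerSeriesAt (0 : ℝ → ℝ)
      (FormalMultilinearSeries.ofScalars ℝ fun n => (taylorCoeff f n).im) 0 := by
    rw [hasFPowerSeriesAt_iff]
    filter_upwards [ball_mem_nhds (0 : ℝ) one_pos] with x hx
    have hx' : (x : ℂ) ∈ ball (0 : ℂ) 1 := by simpa using hx
    have hsum := Complex.hasSum_im (hasSum_taylorCoeff (differentiableOn hf) hx')
    rw [(hf.2 x hx').2 (ofReal_im x)] at hsum
    refine hsum.congr_fun fun k => ?_
    rw [← ofReal_pow, im_mul_ofReal]
    simp [mul_comm]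
  have hcoeff := congrArg (fun p => FormalMultilinearSeries.coeff p n) hzero.eq_zero
  rwa [FormalMultilinearSeries.coeff_ofScalars] at hcoeff

theorem neg_comp_neg (hf : f ∈ TypicallyReal) : (fun z => -f (-z)) ∈ TypicallyReal := by
  refine ⟨⟨?_, by simp [hf.1.2.1], ?_⟩, fun z hz => ?_⟩
  · exact ((differentiableOn hf).comp (differentiableOn_neg _) fun z hz => by simpa using hz).neg
  · have := deriv_comp_neg f 0
    simp [deriv.fun_neg, this, hf.1.2.2]
  · simpa using hf.2 (-z) (by simpa using hz)

theorem eventually_im_mul_I_pos (hf : f ∈ TypicallyReal) :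
    ∀ᶠ t : ℝ in 𝓝[>] 0, 0 < (f (t * I)).im := by
  have hline : HasDerivAt (fun t : ℝ => (t : ℂ) * I) I 0 := by
    simpa using ofRealCLM.hasDerivAt.mul_const I
  have hcomp : HasDerivAt (fun t : ℝ => f (t * I)) I 0 := by
    have hf0 : HasDerivAt f 1 (((0 : ℝ) : ℂ) * I) := by simpa using (hasDerivAt_zero hf)
    simpa [Function.comp_def] using hf0.comp (0 : ℝ) hline
  have him : HasDerivAt (fun t : ℝ => (f (t * I)).im) 1 0 := by
    simpa using! imCLM.hasFDerivAt.comp_hasDerivAt (0 : ℝ) hcomp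
  have hsign := eventually_nhdsWithin_sign_eq_of_deriv_pos
    (f := fun t : ℝ => (f (t * I)).im) (x₀ := 0) (by simp [him.deriv]) (by simp [hf.1.2.1])
  filter_upwards [nhdsWithin_le_nhds hsign, self_mem_nhdsWithin] with t ht htpos
  rwa [sub_zero, sign_pos (mem_Ioi.1 htpos), sign_eq_one_iff] at ht

theorem im_pos (hf : f ∈ TypicallyReal) (hz : z ∈ ball (0 : ℂ) 1) (him : 0 < z.im) :
    0 < (f z).im := by
  by_contra! hneg
  obtain ⟨t, htpos, ht, ht1⟩ :=
    ((eventually_im_mul_I_pos hf).and (Ioo_mem_nhdsGT zero_lt_one)).exists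
  have hconn : IsPreconnected (ball (0 : ℂ) 1 ∩ {w | 0 < w.im}) :=
    ((convex_ball _ _).inter (convex_halfSpace_im_gt 0)).isPreconnected
  have hcont : ContinuousOn (fun w => (f w).im) (ball (0 : ℂ) 1 ∩ {w | 0 < w.im}) :=
    continuous_im.comp_continuousOn ((differentiableOn hf).continuousOn.mono inter_subset_left)
  have htI : (t * I : ℂ) ∈ ball (0 : ℂ) 1 ∩ {w | 0 < w.im} := by
    simpa [abs_of_pos ht] using ⟨ht1, ht⟩
  obtain ⟨w, ⟨hw, hwim⟩, hfw⟩ :=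
    hconn.intermediate_value ⟨hz, him⟩ htI hcont ⟨hneg, htpos.le⟩
  exact hwim.ne' ((hf.2 w hw).1 hfw)

theorem im_neg (hf : f ∈ TypicallyReal) (hz : z ∈ ball (0 : ℂ) 1) (him : z.im < 0) :
    (f z).im < 0 := by
  simpa using im_pos (neg_comp_neg hf) (z := -z) (by simpa using hz) (by simpa using him)

theorem im_mul_im_nonneg (hf : f ∈ TypicallyReal) (hz : z ∈ ball (0 : ℂ) 1) :
    0 ≤ (f z).im * z.im := by
  rcases lt_trichotomy z.im 0 with h | h | h
  · exact mul_nonneg_of_nonpos_of_nonpos (im_neg hf hz h).le h.le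
  · simp [h]
  · exact mul_nonneg (im_pos hf hz h).le h.le

theorem convex : Convex ℝ TypicallyReal := by
  intro f hf g hg a b ha hb hab
  refine ⟨⟨?_, by simp [hf.1.2.1, hg.1.2.1], ?_⟩, fun z hz => ?_⟩
  · exact ((differentiableOn hf).const_smul a).add ((differentiableOn hg).const_smul b)
  · have hderiv := ((hasDerivAt_zero hf).const_smul a).add ((hasDerivAt_zero hg).const_smul b)
    simpa [← ofReal_add, hab] using hderiv.deriv
  · have him : ((a • f + b • g) z).im = a • (f z).im + b • (g z).im := by simp
    rw [him]
    rcases lt_trichotomy z.im 0 with h | h | h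
    · have := convex_Iio (0 : ℝ) (im_neg hf hz h) (im_neg hg hz h) ha hb hab
      exact iff_of_false (mem_Iio.1 this).ne h.ne
    · simp [(hf.2 z hz).2 h, (hg.2 z hz).2 h, h]
    · have := convex_Ioi (0 : ℝ) (im_pos hf hz h) (im_pos hg hz h) ha hb hab
      exact iff_of_false (mem_Ioi.1 this).ne' h.ne'

end TypicallyReal

section CircleAverage

variable {f : ℂ → ℂ} {r : ℝ}

theorem circleAverage_inv_pow_mul (hr : 0 < r) (hf : DifferentiableOn ℂ f (closedBall 0 r))
    (n : ℕ) : Real.circleAverage (fun z => (z ^ n)⁻¹ * f z) 0 r = taylorCoeff f n := by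
  have hcauchy := hf.circleIntegral_one_div_sub_center_pow_smul hr n
  rw [Real.circleAverage_eq_circleIntegral hr.ne']
  simp only [sub_zero, one_div, smul_eq_mul, ← mul_assoc, ← mul_inv, ← pow_succ'] at hcauchy ⊢
  rw [hcauchy, taylorCoeff]
  field_simp [two_pi_I_ne_zero]

theorem circleAverage_pow_mul (hf : DifferentiableOn ℂ f (closedBall 0 |r|)) {n : ℕ}
    (hn : n ≠ 0) : Real.circleAverage (fun z => z ^ n * f z) 0 r = 0 := by
  have hdiff : DiffContOnCl ℂ (fun z => z ^ n * f z) (ball 0 |r|) :=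
    (((differentiableOn_pow n).mul hf).mono closure_ball_subset_closedBall).diffContOnCl
  simp [hdiff.circleAverage, hn]

theorem im_mul_im_pow_eq_re {z : ℂ} (hz : z ≠ 0) (w : ℂ) (n : ℕ) :
    w.im * (z ^ n).im =
      (((‖z‖ ^ (2 * n) / 2 : ℝ) : ℂ) * ((z ^ n)⁻¹ * w) - 1 / 2 * (z ^ n * w)).re := by
  have hconj : ((‖z‖ ^ (2 * n) / 2 : ℝ) : ℂ) * (z ^ n)⁻¹ = conj (z ^ n) / 2 := by
    rw [pow_mul', ← norm_pow, ← normSq_eq_norm_sq, ofReal_div, ← mul_conj]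
    field_simp [pow_ne_zero n hz]
    simp
  rw [← mul_assoc, hconj, div_mul_eq_mul_div, one_div_mul_eq_div]
  simp only [sub_re, div_ofNat_re, mul_re, conj_re, conj_im]
  ring

theorem circleAverage_im_mul_im_pow (hr : 0 < r) (hf : DifferentiableOn ℂ f (closedBall 0 r))
    {n : ℕ} (hn : n ≠ 0) :
    Real.circleAverage (fun z => (f z).im * (z ^ n).im) 0 r
      = r ^ (2 * n) / 2 * (taylorCoeff f n).re := by
  have hcont : ContinuousOn f (sphere 0 |r|) := by
    rw [abs_of_pos hr]
    exact hf.continuousOn.mono sphere_subset_closedBall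
  have hinv : ContinuousOn (fun z : ℂ => (z ^ n)⁻¹) (sphere 0 |r|) :=
    (continuous_pow n).continuousOn.inv₀ fun z hz => pow_ne_zero n <|
      norm_pos_iff.1 (by simpa [mem_sphere_zero_iff_norm.1 hz] using hr.ne')
  have hneg : CircleIntegrable (fun z => (z ^ n)⁻¹ * f z) 0 r :=
    ContinuousOn.circleIntegrable' (hinv.mul hcont)
  have hpos : CircleIntegrable (fun z => z ^ n * f z) 0 r :=
    ContinuousOn.circleIntegrable' ((continuous_pow n).continuousOn.mul hcont)
  calc Real.circleAverage (fun z => (f z).im * (z ^ n).im) 0 r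
      = Real.circleAverage (reCLM ∘ ((((r ^ (2 * n) / 2 : ℝ) : ℂ) • fun z => (z ^ n)⁻¹ * f z)
          - (1 / 2 : ℂ) • fun z => z ^ n * f z)) 0 r := by
        refine Real.circleAverage_congr_sphere fun z hz => ?_
        have hnorm : ‖z‖ = r := by simpa [abs_of_pos hr] using hz
        have hz0 : z ≠ 0 := norm_pos_iff.1 (hnorm ▸ hr)
        simpa [hnorm] using im_mul_im_pow_eq_re hz0 (f z) n
    _ = r ^ (2 * n) / 2 * (taylorCoeff f n).re := by
        rw [reCLM.circleAverage_comp_comm (hneg.const_smul.sub hpos.const_smul),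
          Real.circleAverage_sub hneg.const_smul hpos.const_smul,
          Real.circleAverage_smul, Real.circleAverage_smul, circleAverage_inv_pow_mul hr hf,
          circleAverage_pow_mul (by rwa [abs_of_pos hr]) hn, smul_zero, sub_zero, reCLM_apply,
          smul_eq_mul, re_ofReal_mul]

end CircleAverage

theorem exists_probabilityMeasure_integral_eq_mul_comp {Ω X : Type*} [MeasurableSpace Ω]
    [MeasurableSpace X] {ν : Measure Ω} {w : Ω → ℝ} (hw : Measurable w) (hw0 : 0 ≤ w)
    (hw1 : ∫ ω, w ω ∂ν = 1) {φ : Ω → X} (hφ : Measurable φ) :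
    ∃ μ : ProbabilityMeasure X, ∀ g : X → ℝ, Measurable g →
      ∫ x, g x ∂(μ : Measure X) = ∫ ω, w ω * g (φ ω) ∂ν := by
  let ρ : Measure Ω := ν.withDensity fun ω => ENNReal.ofReal (w ω)
  have hρ : IsProbabilityMeasure ρ := ⟨by
    rw [withDensity_apply _ MeasurableSet.univ, Measure.restrict_univ,
      ← ofReal_integral_eq_lintegral_ofReal (integrable_of_integral_eq_one hw1) (.of_forall hw0),
      hw1, ENNReal.ofReal_one]⟩
  refine ⟨⟨ρ.map φ, Measure.isProbabilityMeasure_map hφ.aemeasurable⟩, fun g hg => ?_⟩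
  rw [ProbabilityMeasure.coe_mk, integral_map hφ.aemeasurable hg.aestronglyMeasurable,
    integral_withDensity_eq_integral_toReal_smul hw.ennreal_ofReal (by simp)]
  simp only [ENNReal.toReal_ofReal (hw0 _), smul_eq_mul]

/-- The `n`-th Robertson coefficient of a probability measure `μ` on `[-1, 1]`, that is, the
`n`-th Taylor coefficient of `z ↦ ∫ z / (1 - 2 * x * z + z ^ 2) ∂μ x`, written by means of the
generating function of the Chebyshev polynomials of the second kind. Since `U (-1) = 0`, the
coefficient at `n = 0` vanishes. -/
noncomputable def robertsonCoeff (μ : ProbabilityMeasure (Icc (-1 : ℝ) 1)) (n : ℕ) : ℝ :=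
  ∫ x : Icc (-1 : ℝ) 1, (Chebyshev.U ℝ (n - 1)).eval (x : ℝ) ∂μ

theorem continuous_integral_of_continuous {X : Type*} [TopologicalSpace X] [CompactSpace X]
    [MeasurableSpace X] [OpensMeasurableSpace X] {g : X → ℝ} (hg : Continuous g) :
    Continuous fun μ : ProbabilityMeasure X => ∫ x, g x ∂(μ : Measure X) :=
  ProbabilityMeasure.continuous_integral_boundedContinuousFunction
    (BoundedContinuousFunction.mkOfCompact ⟨g, hg⟩)

theorem continuous_robertsonCoeff : Continuous robertsonCoeff :=
  continuous_pi fun _ => continuous_integral_of_continuous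
    ((Polynomial.continuous _).comp continuous_subtype_val)

theorem isClosed_range_robertsonCoeff : IsClosed (range robertsonCoeff) :=
  (isCompact_range continuous_robertsonCoeff).isClosed

theorem U_eval_cos_mul_im_circleMap (r θ : ℝ) (n : ℕ) :
    r ^ n * ((Chebyshev.U ℝ (n - 1)).eval (Real.cos θ) * (circleMap 0 r θ).im)
      = r * (circleMap 0 r θ ^ n).im := by
  have hU := Chebyshev.U_real_cos θ (n - 1)
  rw [show (((n : ℤ) - 1 : ℤ) : ℝ) + 1 = n by push_cast; ring] at hU
  rw [circleMap_zero_pow, circleMap_zero_im, circleMap_zero_im, ← hU]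
  ring

/-- The density `θ ↦ Im f(z) Im z / (π r ^ 2)`, `z = r e^{iθ}`, whose image under `cos` is the
measure representing `z ↦ f (r * z) / r` in Robertson's theorem. -/
noncomputable def robertsonDensity (f : ℂ → ℂ) (r θ : ℝ) : ℝ :=
  (Real.pi * r ^ 2)⁻¹ * ((f (circleMap 0 r θ)).im * (circleMap 0 r θ).im)

theorem integral_robertsonDensity_mul_U {f : ℂ → ℂ} {r : ℝ} (hr : 0 < r)
    (hf : DifferentiableOn ℂ f (closedBall 0 r)) {n : ℕ} (hn : n ≠ 0) :
    r * ∫ θ in 0..2 * Real.pi,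
        robertsonDensity f r θ * (Chebyshev.U ℝ (n - 1)).eval (Real.cos θ)
      = r ^ n * (taylorCoeff f n).re := by
  have hpointwise (θ : ℝ) :
      r ^ n * (r * (robertsonDensity f r θ * (Chebyshev.U ℝ (n - 1)).eval (Real.cos θ)))
        = 2 * ((2 * Real.pi)⁻¹ * ((f (circleMap 0 r θ)).im * (circleMap 0 r θ ^ n).im)) := by
    have hU := U_eval_cos_mul_im_circleMap r θ n
    rw [robertsonDensity]
    field_simp
    linear_combination (f (circleMap 0 r θ)).im * hU
  have havg := circleAverage_im_mul_im_pow hr hf hn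
  rw [Real.circleAverage_def, smul_eq_mul] at havg
  refine mul_left_cancel₀ (pow_ne_zero n hr.ne') ?_
  simp_rw [← intervalIntegral.integral_const_mul, hpointwise,
    intervalIntegral.integral_const_mul, havg]
  ring

namespace TypicallyReal

variable {f : ℂ → ℂ} {r : ℝ}

theorem exists_mul_robertsonCoeff_eq (hf : f ∈ TypicallyReal) (hr0 : 0 < r) (hr1 : r < 1) :
    ∃ μ, ∀ n, r * robertsonCoeff μ n = r ^ n * (taylorCoeff f n).re := by
  have hmem (θ : ℝ) : circleMap 0 r θ ∈ ball (0 : ℂ) 1 := by simpa [abs_of_pos hr0] using hr1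
  have hcont : Continuous (robertsonDensity f r) := by
    have hfcont : Continuous fun θ => f (circleMap 0 r θ) :=
      (differentiableOn hf).continuousOn.comp_continuous (continuous_circleMap 0 r) hmem
    exact continuous_const.mul ((continuous_im.comp hfcont).mul
      (continuous_im.comp (continuous_circleMap 0 r)))
  have hnonneg : 0 ≤ robertsonDensity f r := fun θ =>
    mul_nonneg (by positivity) (im_mul_im_nonneg hf (hmem θ))
  have hmoment (n : ℕ) (hn : n ≠ 0) :=
    integral_robertsonDensity_mul_U hr0
      ((differentiableOn hf).mono (closedBall_subset_ball hr1)) hn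
  simp only [intervalIntegral.integral_of_le Real.two_pi_pos.le] at hmoment
  have hmass : ∫ θ in Ioc 0 (2 * Real.pi), robertsonDensity f r θ = 1 := by
    simpa [taylorCoeff_one hf, hr0.ne'] using hmoment 1 one_ne_zero
  obtain ⟨μ, hμ⟩ := exists_probabilityMeasure_integral_eq_mul_comp hcont.measurable hnonneg hmass
    (φ := fun θ => (⟨Real.cos θ, Real.cos_mem_Icc θ⟩ : Icc (-1 : ℝ) 1)) (by fun_prop)
  refine ⟨μ, fun n => ?_⟩
  rcases eq_or_ne n 0 with rfl | hn
  · simp [robertsonCoeff, taylorCoeff_zero hf]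
  · rw [robertsonCoeff, hμ _ (by fun_prop), hmoment n hn]

theorem exists_robertsonCoeff_eq (hf : f ∈ TypicallyReal) :
    ∃ μ, ∀ n, taylorCoeff f n = robertsonCoeff μ n := by
  have hmem : ∀ᶠ r : ℝ in 𝓝[<] 1,
      (fun n => r ^ n * (taylorCoeff f n).re / r) ∈ range robertsonCoeff := by
    filter_upwards [Ioo_mem_nhdsLT zero_lt_one] with r hr
    obtain ⟨μ, hμ⟩ := exists_mul_robertsonCoeff_eq hf hr.1 hr.2
    exact ⟨μ, funext fun n => (eq_div_iff hr.1.ne').2 (by rw [mul_comm, hμ])⟩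
  have hlim : Tendsto (fun (r : ℝ) n => r ^ n * (taylorCoeff f n).re / r) (𝓝[<] 1)
      (𝓝 fun n => (taylorCoeff f n).re) := by
    refine tendsto_nhdsWithin_of_tendsto_nhds (tendsto_pi_nhds.2 fun n => ?_)
    have hcont : ContinuousAt (fun r : ℝ => r ^ n * (taylorCoeff f n).re / r) 1 := by
      fun_prop (disch := norm_num)
    simpa using hcont.tendsto
  obtain ⟨μ, hμ⟩ := isClosed_range_robertsonCoeff.mem_of_tendsto hlim hmem
  exact ⟨μ, fun n => Complex.ext (by simp [hμ]) (by simp [taylorCoeff_im hf])⟩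

end TypicallyReal

section ChebyshevMoment

variable (μ : ProbabilityMeasure (Icc (-1 : ℝ) 1))

/-- The `n`-th trigonometric moment `∫ cos (n θ)` of `μ`, in the variable `x = cos θ`. -/
noncomputable def chebyshevMoment (n : ℕ) : ℝ :=
  ∫ x : Icc (-1 : ℝ) 1, (Chebyshev.T ℝ n).eval (x : ℝ) ∂μ

theorem abs_chebyshevMoment_le_one (n : ℕ) : |chebyshevMoment μ n| ≤ 1 := by
  have hbound (x : Icc (-1 : ℝ) 1) : ‖(Chebyshev.T ℝ n).eval (x : ℝ)‖ ≤ 1 :=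
    Chebyshev.abs_eval_T_real_le_one n (abs_le.2 x.2)
  simpa [chebyshevMoment] using
    norm_integral_le_of_norm_le_const (μ := (μ : Measure (Icc (-1 : ℝ) 1))) (.of_forall hbound)

theorem integrable_polynomial_eval (p : ℝ[X]) :
    Integrable (fun x : Icc (-1 : ℝ) 1 => p.eval (x : ℝ)) μ :=
  (p.continuous.comp continuous_subtype_val).integrable_of_hasCompactSupport
    (.of_compactSpace _)

theorem sq_integral_polynomial_eval_le (p : ℝ[X]) :
    (∫ x : Icc (-1 : ℝ) 1, p.eval (x : ℝ) ∂μ) ^ 2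
      ≤ ∫ x : Icc (-1 : ℝ) 1, (p ^ 2).eval (x : ℝ) ∂μ := by
  have hsq := integrable_polynomial_eval μ (p ^ 2)
  simp only [eval_pow] at hsq ⊢
  exact even_two.convexOn_pow.map_integral_le (continuous_pow 2).continuousOn isClosed_univ
    (by simp) (integrable_polynomial_eval μ p) hsq

theorem sq_eval_T_add_mul_le {ε x : ℝ} (hε : ε ^ 2 = 1) (hx : x ∈ Icc (-1) 1) (j k : ℤ) :
    ((Chebyshev.T ℝ j).eval x + ε * (Chebyshev.T ℝ k).eval x) ^ 2
      ≤ 2 * (1 + ε * (Chebyshev.T ℝ (j + k)).eval x) := by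
  rw [← Real.cos_arccos hx.1 hx.2]
  generalize Real.arccos x = θ
  simp only [Chebyshev.T_real_cos, Int.cast_add, add_mul, Real.cos_add]
  nlinarith [sq_nonneg (Real.sin (j * θ) - ε * Real.sin (k * θ)), Real.sin_sq_add_cos_sq (j * θ),
    Real.sin_sq_add_cos_sq (k * θ)]

theorem sq_chebyshevMoment_add_mul_le {ε : ℝ} (hε : ε ^ 2 = 1) (j k : ℕ) :
    (chebyshevMoment μ j + ε * chebyshevMoment μ k) ^ 2
      ≤ 2 * (1 + ε * chebyshevMoment μ (j + k)) := by
  let p : ℝ[X] := Chebyshev.T ℝ j + C ε * Chebyshev.T ℝ k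
  let q : ℝ[X] := C 2 * (1 + C ε * Chebyshev.T ℝ (j + k : ℕ))
  have hp : ∫ x : Icc (-1 : ℝ) 1, p.eval (x : ℝ) ∂μ
      = chebyshevMoment μ j + ε * chebyshevMoment μ k := by
    simp only [p, eval_add, eval_mul, eval_C, chebyshevMoment]
    rw [integral_add (integrable_polynomial_eval μ _)
      ((integrable_polynomial_eval μ _).const_mul ε), integral_const_mul]
  have hq : ∫ x : Icc (-1 : ℝ) 1, q.eval (x : ℝ) ∂μ
      = 2 * (1 + ε * chebyshevMoment μ (j + k)) := by
    simp only [q, eval_add, eval_mul, eval_C, eval_one, chebyshevMoment]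
    rw [integral_const_mul, integral_add (integrable_const _)
      ((integrable_polynomial_eval μ _).const_mul ε), integral_const_mul]
    simp
  rw [← hp, ← hq]
  refine (sq_integral_polynomial_eval_le μ p).trans (integral_mono
    (integrable_polynomial_eval μ _) (integrable_polynomial_eval μ _) fun x => ?_)
  simpa [p, q] using sq_eval_T_add_mul_le hε x.2 j k

theorem abs_two_mul_chebyshevMoment_mul_sub_le_one (j k : ℕ) :
    |2 * chebyshevMoment μ j * chebyshevMoment μ k - chebyshevMoment μ (j + k)| ≤ 1 := by
  have hadd := sq_chebyshevMoment_add_mul_le μ (ε := 1) (by norm_num) j k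
  have hsub := sq_chebyshevMoment_add_mul_le μ (ε := -1) (by norm_num) j k
  rw [abs_le]
  constructor <;> nlinarith [sq_nonneg (chebyshevMoment μ j + chebyshevMoment μ k),
    sq_nonneg (chebyshevMoment μ j - chebyshevMoment μ k)]

theorem robertsonCoeff_zero : robertsonCoeff μ 0 = 0 := by
  simp [robertsonCoeff]

theorem robertsonCoeff_one : robertsonCoeff μ 1 = 1 := by
  simp [robertsonCoeff]

theorem robertsonCoeff_add_two (n : ℕ) :
    robertsonCoeff μ (n + 2) = robertsonCoeff μ n + 2 * chebyshevMoment μ (n + 1) := by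
  have hU : Chebyshev.U ℝ ((n + 2 : ℕ) - 1)
      = 2 * Chebyshev.T ℝ (n + 1 : ℕ) + Chebyshev.U ℝ (n - 1) := by
    convert Chebyshev.U_eq_two_mul_T_add_U ℝ ((n : ℤ) - 1) using 3 <;> lia
  simp only [robertsonCoeff, hU, eval_add, eval_mul, eval_ofNat, chebyshevMoment]
  rw [integral_add ((integrable_polynomial_eval μ _).const_mul 2)
    (integrable_polynomial_eval μ _), integral_const_mul, add_comm]

theorem abs_robertsonCoeff_le (n : ℕ) : |robertsonCoeff μ n| ≤ n := by
  induction n using Nat.twoStepInduction with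
  | zero => simp [robertsonCoeff_zero]
  | one => simp [robertsonCoeff_one]
  | more n ih _ =>
    have hc := abs_le.1 (abs_chebyshevMoment_le_one μ (n + 1))
    rw [abs_le] at ih ⊢
    rw [robertsonCoeff_add_two]
    push_cast
    constructor <;> linarith

end ChebyshevMoment

theorem zalcman_comm (f : ℂ → ℂ) (n m : ℕ) (lam : ℝ) : zalcman f n m lam = zalcman f m n lam := by
  rw [zalcman, zalcman, add_comm n m, mul_right_comm]

theorem abs_mul_chebyshevMoment_mul_robertsonCoeff_sub_le (μ : ProbabilityMeasure (Icc (-1 : ℝ) 1))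
    (j k : ℕ) {lam : ℝ} (hlam : 1 ≤ lam) :
    |lam * (chebyshevMoment μ j * robertsonCoeff μ (k + 1)) - chebyshevMoment μ (j + k)|
      ≤ lam * (k + 1) - 1 := by
  have hcj := abs_chebyshevMoment_le_one μ j
  rcases k with _ | k
  · simp only [zero_add, robertsonCoeff_one, mul_one, add_zero, CharP.cast_eq_zero]
    rw [← sub_one_mul, abs_mul, abs_of_nonneg (sub_nonneg.2 hlam)]
    exact mul_le_of_le_one_right (sub_nonneg.2 hlam) hcj
  · have hck := abs_chebyshevMoment_le_one μ (k + 1)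
    have hcA : |chebyshevMoment μ j * robertsonCoeff μ k| ≤ k := by
      rw [abs_mul]
      exact (mul_le_of_le_one_left (abs_nonneg _) hcj).trans (abs_robertsonCoeff_le μ k)
    have hcc : |chebyshevMoment μ j * chebyshevMoment μ (k + 1)| ≤ 1 := by
      rw [abs_mul]
      exact mul_le_one₀ hcj (abs_nonneg _) hck
    have hprod := abs_two_mul_chebyshevMoment_mul_sub_le_one μ j (k + 1)
    calc _ = |lam * (chebyshevMoment μ j * robertsonCoeff μ k)
          + 2 * (lam - 1) * (chebyshevMoment μ j * chebyshevMoment μ (k + 1))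
          + (2 * chebyshevMoment μ j * chebyshevMoment μ (k + 1)
            - chebyshevMoment μ (j + (k + 1)))| := by
          rw [robertsonCoeff_add_two]
          ring_nf
      _ ≤ lam * k + 2 * (lam - 1) * 1 + 1 := by
          refine (abs_add_three _ _ _).trans ?_
          rw [abs_mul lam, abs_mul (2 * (lam - 1)), abs_of_nonneg (by linarith : 0 ≤ lam),
            abs_of_nonneg (by linarith : 0 ≤ 2 * (lam - 1))]
          gcongr
      _ = lam * ((k + 1 : ℕ) + 1) - 1 := by
          push_cast
          ring

namespace TypicallyReal

variable {f : ℂ → ℂ} {n m : ℕ} {lam : ℝ}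

theorem exists_zalcman_eq (hf : f ∈ TypicallyReal) :
    ∃ μ, ∀ n m lam, zalcman f n m lam =
      |lam * robertsonCoeff μ n * robertsonCoeff μ m - robertsonCoeff μ (n + m - 1)| := by
  obtain ⟨μ, hμ⟩ := exists_robertsonCoeff_eq hf
  refine ⟨μ, fun n m lam => ?_⟩
  rw [zalcman, hμ, hμ, hμ]
  exact_mod_cast Complex.norm_real _

theorem zalcman_add_two_le (hf : f ∈ TypicallyReal) (hm : 1 ≤ m) (hlam : 1 ≤ lam) (n : ℕ) :
    zalcman f (n + 2) m lam ≤ zalcman f n m lam + 2 * (lam * m - 1) := by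
  obtain ⟨μ, hμ⟩ := exists_zalcman_eq hf
  obtain ⟨k, rfl⟩ := Nat.exists_eq_add_of_le' hm
  have hblock := abs_mul_chebyshevMoment_mul_robertsonCoeff_sub_le μ (n + 1) k hlam
  rw [hμ, hμ, show n + 2 + (k + 1) - 1 = n + k + 2 by lia, show n + (k + 1) - 1 = n + k by lia,
    robertsonCoeff_add_two, robertsonCoeff_add_two, show n + k + 1 = n + 1 + k by lia]
  calc _ = |(lam * robertsonCoeff μ n * robertsonCoeff μ (k + 1) - robertsonCoeff μ (n + k))
        + 2 * (lam * (chebyshevMoment μ (n + 1) * robertsonCoeff μ (k + 1))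
          - chebyshevMoment μ (n + 1 + k))| := by ring_nf
    _ ≤ _ := (abs_add_le _ _).trans (by rw [abs_mul, abs_two]; push_cast; linarith)

theorem zalcman_add_two_mul_le (hf : f ∈ TypicallyReal) (hm : 1 ≤ m) (hlam : 1 ≤ lam)
    (n k : ℕ) : zalcman f (n + 2 * k) m lam ≤ zalcman f n m lam + 2 * k * (lam * m - 1) := by
  induction k with
  | zero => simp
  | succ k ih =>
    have hstep := zalcman_add_two_le hf hm hlam (n + 2 * k)
    rw [mul_add_one, ← add_assoc]
    push_cast
    linarith

theorem zalcman_one_le (hf : f ∈ TypicallyReal) (hlam : 1 ≤ lam) (m : ℕ) :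
    zalcman f 1 m lam ≤ (lam - 1) * m := by
  obtain ⟨μ, hμ⟩ := exists_zalcman_eq hf
  rw [hμ, robertsonCoeff_one, mul_one, Nat.add_sub_cancel_left, ← sub_one_mul, abs_mul,
    abs_of_nonneg (sub_nonneg.2 hlam)]
  exact mul_le_mul_of_nonneg_left (abs_robertsonCoeff_le μ m) (sub_nonneg.2 hlam)

theorem zalcman_two_two_le (hf : f ∈ TypicallyReal) (hlam : 1 ≤ lam) :
    zalcman f 2 2 lam ≤ max 3 (4 * lam - 3) := by
  obtain ⟨μ, hμ⟩ := exists_zalcman_eq hf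
  have hc1 : chebyshevMoment μ 1 ^ 2 ≤ 1 :=
    (sq_le_one_iff_abs_le_one _).2 (abs_chebyshevMoment_le_one μ 1)
  have hc2 := abs_le.1 (abs_chebyshevMoment_le_one μ 2)
  have hc11 := abs_le.1 (abs_two_mul_chebyshevMoment_mul_sub_le_one μ 1 1)
  have hphi : zalcman f 2 2 lam =
      |4 * (lam * chebyshevMoment μ 1 ^ 2) - 1 - 2 * chebyshevMoment μ 2| := by
    simp only [hμ, robertsonCoeff_add_two, robertsonCoeff_zero, robertsonCoeff_one,
      Nat.reduceAdd, Nat.reduceSub]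
    ring_nf
  rw [hphi]
  refine abs_le.2 ⟨?_, le_max_of_le_right ?_⟩
  · have hnonneg : 0 ≤ lam * chebyshevMoment μ 1 ^ 2 := by positivity
    linarith [le_max_left 3 (4 * lam - 3)]
  · have hlamc1 := mul_le_of_le_one_right (sub_nonneg.2 hlam) hc1
    linarith

theorem zalcman_four_four_le (hf : f ∈ TypicallyReal) (hlam : 1 ≤ lam) :
    zalcman f 4 4 lam ≤ 16 * lam - 7 := by
  obtain ⟨μ, hμ⟩ := exists_zalcman_eq hf
  have hA4 : robertsonCoeff μ 4 = 2 * (chebyshevMoment μ 1 + chebyshevMoment μ 3) := by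
    simp only [robertsonCoeff_add_two, robertsonCoeff_zero, Nat.reduceAdd]
    ring
  have hA7 : robertsonCoeff μ 7 =
      1 + 2 * (chebyshevMoment μ 2 + chebyshevMoment μ 4 + chebyshevMoment μ 6) := by
    simp only [robertsonCoeff_add_two, robertsonCoeff_one, Nat.reduceAdd]
    ring
  have hA4_sq : robertsonCoeff μ 4 ^ 2 ≤ 4 ^ 2 :=
    sq_le_sq.2 (by simpa using abs_robertsonCoeff_le μ 4)
  have hA7_abs := abs_le.1 (abs_robertsonCoeff_le μ 7)
  have hc4 := abs_le.1 (abs_chebyshevMoment_le_one μ 4)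
  have hc11 := abs_le.1 (abs_two_mul_chebyshevMoment_mul_sub_le_one μ 1 1)
  have hc13 := abs_le.1 (abs_two_mul_chebyshevMoment_mul_sub_le_one μ 1 3)
  have hc33 := abs_le.1 (abs_two_mul_chebyshevMoment_mul_sub_le_one μ 3 3)
  have hone : robertsonCoeff μ 4 ^ 2 - robertsonCoeff μ 7 ≤ 9 := by
    rw [hA4, hA7]
    linarith
  have hphi : zalcman f 4 4 lam = |lam * robertsonCoeff μ 4 ^ 2 - robertsonCoeff μ 7| := by
    rw [hμ, mul_assoc, sq]
  rw [hphi]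
  push_cast at hA7_abs
  refine abs_le.2 ⟨?_, ?_⟩
  · have hnonneg : 0 ≤ lam * robertsonCoeff μ 4 ^ 2 := by positivity
    linarith
  · have hlamA4 := mul_le_mul_of_nonneg_left hA4_sq (sub_nonneg.2 hlam)
    linarith

theorem zalcman_le_of_odd (hf : f ∈ TypicallyReal) (hn : Odd n) (hm : 1 ≤ m) (hlam : 1 ≤ lam) :
    zalcman f n m lam ≤ lam * m * n - n - m + 1 := by
  obtain ⟨k, rfl⟩ := hn
  have hstep := zalcman_add_two_mul_le hf hm hlam 1 k
  have hbase := zalcman_one_le hf hlam m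
  rw [add_comm (2 * k)]
  push_cast
  linarith

theorem zalcman_le_of_even (hf : f ∈ TypicallyReal) (hn : Even n) (hm : Even m) (hn4 : 4 ≤ n)
    (hm4 : 4 ≤ m) (hlam : 1 ≤ lam) : zalcman f n m lam ≤ lam * m * n - n - m + 1 := by
  obtain ⟨k, rfl⟩ : ∃ k, n = 4 + 2 * k := by
    obtain ⟨k, rfl⟩ := hn
    exact ⟨k - 2, by lia⟩
  obtain ⟨l, rfl⟩ : ∃ l, m = 4 + 2 * l := by
    obtain ⟨l, rfl⟩ := hm
    exact ⟨l - 2, by lia⟩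
  have hbase := zalcman_four_four_le hf hlam
  have hright := zalcman_add_two_mul_le hf (m := 4) (by norm_num) hlam 4 l
  have hleft := zalcman_add_two_mul_le hf (m := 4 + 2 * l) (by lia) hlam 4 k
  rw [zalcman_comm f 4 (4 + 2 * l)] at hleft
  push_cast at hleft hright ⊢
  linarith

theorem zalcman_le_of_not_two_even (hf : f ∈ TypicallyReal) (hn : 2 ≤ n) (hm : 2 ≤ m)
    (hlam : 1 ≤ lam) (hn2 : ¬(n = 2 ∧ Even m)) (hm2 : ¬(m = 2 ∧ Even n)) :
    zalcman f n m lam ≤ lam * m * n - n - m + 1 := by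
  rcases Nat.even_or_odd n with hne | hno
  · rcases Nat.even_or_odd m with hme | hmo
    · exact zalcman_le_of_even hf hne hme (by grind) (by grind) hlam
    · rw [zalcman_comm]
      linarith [zalcman_le_of_odd hf hmo (one_le_two.trans hn) hlam]
  · exact zalcman_le_of_odd hf hno (one_le_two.trans hm) hlam

theorem zalcman_two_le_of_even (hf : f ∈ TypicallyReal) (hm : Even m) (hm2 : 2 ≤ m)
    (hlam : 1 ≤ lam) :
    zalcman f 2 m lam ≤ max 3 (4 * lam - 3) + (2 * lam - 1) * (m - 2) := by
  obtain ⟨l, rfl⟩ : ∃ l, m = 2 + 2 * l := by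
    obtain ⟨l, rfl⟩ := hm
    exact ⟨l - 1, by lia⟩
  have hbase := zalcman_two_two_le hf hlam
  have hstep := zalcman_add_two_mul_le hf (m := 2) (by norm_num) hlam 2 l
  rw [zalcman_comm]
  push_cast at hstep ⊢
  linarith

end TypicallyReal

/-- The Koebe function, extremal in the cases where the bound is `lam * m * n - n - m + 1`. -/
noncomputable def koebe (z : ℂ) : ℂ := z / (1 - z) ^ 2

/-- The odd part of the Koebe function, extremal when the even coefficients should vanish. -/
noncomputable def oddKoebe : ℂ → ℂ :=
  (1 / 2 : ℝ) • koebe + (1 / 2 : ℝ) • fun z => -koebe (-z)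

theorem one_sub_ne_zero_of_norm_lt_one {z : ℂ} (hz : ‖z‖ < 1) : 1 - z ≠ 0 :=
  (isUnit_one_sub_of_norm_lt_one hz).ne_zero

theorem koebe_im {z : ℂ} (hz : ‖z‖ < 1) :
    (koebe z).im = z.im * ((1 - ‖z‖ ^ 2) / normSq (1 - z) ^ 2) := by
  have hne : normSq (1 - z) ≠ 0 := normSq_eq_zero.not.2 (one_sub_ne_zero_of_norm_lt_one hz)
  rw [koebe, div_im, map_pow, ← normSq_eq_norm_sq]
  field_simp
  simp only [normSq_apply, sq, mul_im, mul_re, sub_im, sub_re, one_im, one_re]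
  ring

theorem differentiableOn_koebe : DifferentiableOn ℂ koebe (ball 0 1) :=
  differentiableOn_id.div ((differentiableOn_const 1).sub differentiableOn_id |>.pow 2)
    fun _ hz => pow_ne_zero 2 (one_sub_ne_zero_of_norm_lt_one (mem_ball_zero_iff.1 hz))

theorem taylorCoeff_koebe (n : ℕ) : taylorCoeff koebe n = n := by
  refine taylorCoeff_eq_of_eventually_hasSum (a := fun n => (n : ℂ)) ?_ n
  filter_upwards [ball_mem_nhds (0 : ℂ) one_pos] with z hz
  exact hasSum_coe_mul_geometric_of_norm_lt_one (mem_ball_zero_iff.1 hz)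

theorem koebe_mem_typicallyReal : koebe ∈ TypicallyReal := by
  refine ⟨⟨differentiableOn_koebe, by simp [koebe], ?_⟩, fun z hz => ?_⟩
  · simpa [taylorCoeff] using taylorCoeff_koebe 1
  · have hz' : ‖z‖ < 1 := mem_ball_zero_iff.1 hz
    have hnum : 0 < 1 - ‖z‖ ^ 2 := sub_pos.2 (pow_lt_one₀ (norm_nonneg z) hz' two_ne_zero)
    have hden := normSq_pos.2 (one_sub_ne_zero_of_norm_lt_one hz')
    rw [koebe_im hz', mul_eq_zero, or_iff_left (by positivity)]

theorem oddKoebe_mem_typicallyReal : oddKoebe ∈ TypicallyReal :=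
  TypicallyReal.convex koebe_mem_typicallyReal
    (TypicallyReal.neg_comp_neg koebe_mem_typicallyReal) (by norm_num) (by norm_num) (by norm_num)

theorem taylorCoeff_oddKoebe (n : ℕ) : taylorCoeff oddKoebe n = n * (1 - (-1) ^ n) / 2 := by
  refine taylorCoeff_eq_of_eventually_hasSum (a := fun n => (n : ℂ) * (1 - (-1) ^ n) / 2) ?_ n
  filter_upwards [ball_mem_nhds (0 : ℂ) one_pos] with z hz
  have hz' : ‖z‖ < 1 := mem_ball_zero_iff.1 hz
  have hpos := hasSum_coe_mul_geometric_of_norm_lt_one hz'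
  have hneg := hasSum_coe_mul_geometric_of_norm_lt_one (show ‖-z‖ < 1 by rwa [norm_neg])
  have hodd : oddKoebe z = (z / (1 - z) ^ 2 - -z / (1 - -z) ^ 2) / 2 := by
    simp only [oddKoebe, koebe, Pi.add_apply, Pi.smul_apply, real_smul]
    push_cast
    ring
  rw [hodd]
  refine ((hpos.sub hneg).div_const 2).congr_fun fun k => ?_
  rw [neg_pow]
  ring

theorem zalcman_koebe {n m : ℕ} (hn : 1 ≤ n) (hm : 1 ≤ m) {lam : ℝ} (hlam : 1 ≤ lam) :
    zalcman koebe n m lam = lam * m * n - n - m + 1 := by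
  have hn' : (1 : ℝ) ≤ n := by exact_mod_cast hn
  have hm' : (1 : ℝ) ≤ m := by exact_mod_cast hm
  have hprod : 0 ≤ lam * n * m - ((n + m - 1 : ℕ) : ℝ) := by
    rw [Nat.cast_sub (by lia)]
    push_cast
    nlinarith [mul_nonneg (sub_nonneg.2 hn') (sub_nonneg.2 hm'),
      mul_nonneg (sub_nonneg.2 hlam) (by positivity : (0 : ℝ) ≤ n * m)]
  rw [zalcman, taylorCoeff_koebe, taylorCoeff_koebe, taylorCoeff_koebe]
  calc ‖(lam : ℂ) * n * m - (n + m - 1 : ℕ)‖ = ‖lam * n * m - ((n + m - 1 : ℕ) : ℝ)‖ := by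
        rw [← Complex.norm_real]
        push_cast
        rfl
    _ = lam * m * n - n - m + 1 := by
        rw [Real.norm_of_nonneg hprod, Nat.cast_sub (by lia)]
        push_cast
        ring

theorem zalcman_oddKoebe {n m : ℕ} (hn : Even n) (hm : Even m) (hm2 : 2 ≤ m) (lam : ℝ) :
    zalcman oddKoebe n m lam = n + m - 1 := by
  have hodd : Odd (n + m - 1) := Nat.Even.sub_odd (by lia) (hn.add hm) odd_one
  rw [zalcman, taylorCoeff_oddKoebe, taylorCoeff_oddKoebe, taylorCoeff_oddKoebe, hn.neg_one_pow,
    hm.neg_one_pow, hodd.neg_one_pow]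
  calc _ = ‖((n + m - 1 : ℕ) : ℂ)‖ := by
        rw [← norm_neg]
        ring_nf
    _ = n + m - 1 := by
        rw [Complex.norm_natCast, Nat.cast_sub (by lia)]
        push_cast
        ring

theorem zalcman_two_even_sharp {m : ℕ} (hm2 : 2 ≤ m) (hm : Even m) {lam : ℝ} (hlam : 1 ≤ lam) :
    (lam ≤ 3 / 2 →
      (∀ f ∈ TypicallyReal, zalcman f 2 m lam ≤ 3 + (2 * lam - 1) * ((m : ℝ) - 2)) ∧
      (lam = 1 ∨ m = 2 →
        ∃ f ∈ TypicallyReal, zalcman f 2 m lam = 3 + (2 * lam - 1) * ((m : ℝ) - 2))) ∧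
    (3 / 2 ≤ lam →
      (∀ f ∈ TypicallyReal, zalcman f 2 m lam ≤ 2 * lam * m - m - 1) ∧
      (∃ f ∈ TypicallyReal, zalcman f 2 m lam = 2 * lam * m - m - 1)) := by
  refine ⟨fun hlam' => ⟨fun f hf => ?_, fun h => ⟨oddKoebe, oddKoebe_mem_typicallyReal, ?_⟩⟩,
    fun hlam' => ⟨fun f hf => ?_, koebe, koebe_mem_typicallyReal, ?_⟩⟩
  · have hbound := TypicallyReal.zalcman_two_le_of_even hf hm hm2 hlam
    rwa [max_eq_left (by linarith)] at hbound
  · rw [zalcman_oddKoebe even_two hm hm2]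
    rcases h with rfl | rfl <;> push_cast <;> ring
  · have hbound := TypicallyReal.zalcman_two_le_of_even hf hm hm2 hlam
    rw [max_eq_right (by linarith)] at hbound
    linarith
  · rw [zalcman_koebe one_le_two (by lia) hlam]
    push_cast
    ring

theorem mainTheorem4 (n m : ℕ) (hn : 2 ≤ n) (hm : 2 ≤ m) (lam : ℝ) (hlam : 1 ≤ lam) :
    -- (i) `n = 2` and `m` even
    (n = 2 → Even m →
      (lam ≤ 3 / 2 →
        (∀ f ∈ TypicallyReal, zalcman f n m lam ≤ 3 + (2 * lam - 1) * ((m : ℝ) - 2)) ∧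
        ((lam = 1 ∨ (n = 2 ∧ m = 2)) →
          ∃ f ∈ TypicallyReal, zalcman f n m lam = 3 + (2 * lam - 1) * ((m : ℝ) - 2))) ∧
      (3 / 2 ≤ lam →
        (∀ f ∈ TypicallyReal, zalcman f n m lam ≤ 2 * lam * m - m - 1) ∧
        (∃ f ∈ TypicallyReal, zalcman f n m lam = 2 * lam * m - m - 1))) ∧
    -- (ii) `m = 2` and `n` even
    (m = 2 → Even n →
      (lam ≤ 3 / 2 →
        (∀ f ∈ TypicallyReal, zalcman f n m lam ≤ 3 + (2 * lam - 1) * ((n : ℝ) - 2)) ∧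
        ((lam = 1 ∨ (n = 2 ∧ m = 2)) →
          ∃ f ∈ TypicallyReal, zalcman f n m lam = 3 + (2 * lam - 1) * ((n : ℝ) - 2))) ∧
      (3 / 2 ≤ lam →
        (∀ f ∈ TypicallyReal, zalcman f n m lam ≤ 2 * lam * n - n - 1) ∧
        (∃ f ∈ TypicallyReal, zalcman f n m lam = 2 * lam * n - n - 1))) ∧
    -- (iii) all other cases
    (¬ (n = 2 ∧ Even m) → ¬ (m = 2 ∧ Even n) →
      (∀ f ∈ TypicallyReal, zalcman f n m lam ≤ lam * m * n - n - m + 1) ∧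
      (∃ f ∈ TypicallyReal, zalcman f n m lam = lam * m * n - n - m + 1)) := by
  refine ⟨?_, ?_, fun hn2 hm2 => ⟨fun f hf => ?_, koebe, koebe_mem_typicallyReal, ?_⟩⟩
  · rintro rfl hme
    simpa using zalcman_two_even_sharp hm hme hlam
  · rintro rfl hne
    simp_rw [fun f => zalcman_comm f n 2 lam]
    simpa using zalcman_two_even_sharp hn hne hlam
  · exact TypicallyReal.zalcman_le_of_not_two_even hf hn hm hlam hn2 hm2
  · exact zalcman_koebe (one_le_two.trans hn) (one_le_two.trans hm) hlam
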